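/- Let $p>3$ be a prime and let $X$ be a connected (finite, simple, undirected) graph of order $6p$. Suppose that $X$ is genuinely imprimitive with blocks of size $2p$; that is, there are a subgroup $G$ of $\mathrm{Aut}(X)$ acting transitively on $V(X)$ and a normal subgroup $N$ of $G$ such that the set $\mathcal B$ of orbits of $N$ on $V(X)$ is an imprimitivity block system of $G$ (a $G$-invariant partition of $V(X)$ different from $\{V(X)\}$ and from $\{\{v\} : v\in V(X)\}$) in which every block has size $2p$ (so that there are three blocks). Then $X$ has a Hamilton path, i.e. a path that meets every vertex of $X$. -/

import Mathlib

namespace VTGraph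

variable {V : Type*}

/-- A group `G` of automorphisms of the graph `X` is transitive (on the vertices). -/
def IsTransitiveGroup {X : SimpleGraph V} (G : Subgroup (X ≃g X)) : Prop :=
  MulAction.IsPretransitive G V

/-- A partition `ℬ` of the vertex set is `G`-invariant if the elements of `G` permute its
parts setwise. -/
def IsInvariantPartition {X : SimpleGraph V} (G : Subgroup (X ≃g X)) (ℬ : Set (Set V)) : Prop :=
  Setoid.IsPartition ℬ ∧ ∀ g ∈ G, ∀ B ∈ ℬ, (fun v => g v) '' B ∈ ℬ

/-- An imprimitivity block system of a transitive group `G` of automorphisms of `X`: a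
`G`-invariant partition of the vertex set other than the two trivial partitions `{V}` and
`{{v} : v ∈ V}`. -/
structure IsImprimitivityBlockSystem {X : SimpleGraph V} (G : Subgroup (X ≃g X))
    (ℬ : Set (Set V)) : Prop where
  transitive : IsTransitiveGroup G
  invariant : IsInvariantPartition G ℬ
  ne_univ : ℬ ≠ {Set.univ}
  ne_singletons : ℬ ≠ Set.range (fun v : V => ({v} : Set V))

/-- The set of orbits, on the vertices of `X`, of a subgroup `N` of a group `G` of automorphisms
of `X`. -/
def orbitPartition {X : SimpleGraph V} {G : Subgroup (X ≃g X)} (N : Subgroup G) : Set (Set V) :=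
  Set.range (fun v : V => MulAction.orbit N v)

/-- The graph `X` is genuinely imprimitive with block system `ℬ`: for some transitive group `G` of
automorphisms of `X`, the partition `ℬ` is an imprimitivity block system of `G` formed by the
orbits of a normal subgroup of `G`. -/
def IsGenuinelyImprimitiveWith (X : SimpleGraph V) (ℬ : Set (Set V)) : Prop :=
  ∃ G : Subgroup (X ≃g X), IsImprimitivityBlockSystem G ℬ ∧
    ∃ N : Subgroup G, N.Normal ∧ ℬ = orbitPartition N

/-- A path that meets every vertex of `X`. -/
def HasHamiltonPath [DecidableEq V] (X : SimpleGraph V) : Prop :=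
  ∃ (u v : V) (w : X.Walk u v), w.IsHamiltonian

end VTGraph

namespace VTGraph

variable {V : Type*}

/-! The orbits of `N` have size `2p`, and a Sylow `p`-subgroup of `N` yields an automorphism of
order `p` with six orbits of size `p`, two in each block (`exists_semiregular_of_ncard_orbit`). So
`X` is a cyclic cover of a quotient on the six pairs `(i, a)`, whose edges carry voltages ("steps")
in `ZMod p`. By symmetry every vertex has `r` neighbours in its own block and `d` in each other
block.

A Hamilton cycle of the quotient with nonzero voltage sum lifts to a Hamilton cycle of `X`, and a
multiple edge on a quotient cycle always allows a nonzero sum. If each orbit induces a nonempty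
graph, a Hamilton path of the quotient suffices.

If `r ≥ 2`, then either the two orbits of some block are joined by at least two edges at each
vertex, and each block has a Hamilton path starting at any of its vertices, or every orbit induces a
nonempty graph. If `r ≤ 1`, the orbits are independent sets. Without a Hamilton path all voltage
sums along Hamilton cycles of the quotient vanish. This forces the quotient to be a hexagon with all
or none of its short chords and all or none of its long ones, or a prism, or two disjoint triangles.
The last is disconnected; in the others the linear equations make the voltages a coboundary
(`false_of_hexagon`, `false_of_prism`), so `X` is disconnected, a contradiction. Solving the
equations requires division by 2 and, for long chords without short ones, by 3: hence `p > 3`. -/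

/-! ### Hamilton paths from sequences of vertices -/

theorem exists_walk_support_eq_map_range (X : SimpleGraph V) (f : ℕ → V) (n : ℕ)
    (hadj : ∀ k, k < n → X.Adj (f k) (f (k + 1))) :
    ∃ w : X.Walk (f 0) (f n), w.support = (List.range (n + 1)).map f := by
  induction n with
  | zero => exact ⟨SimpleGraph.Walk.nil, by simp⟩
  | succ n ih =>
    obtain ⟨w, hw⟩ := ih fun k hk => hadj k (by omega)
    refine ⟨w.concat (hadj n (by omega)), ?_⟩
    rw [SimpleGraph.Walk.support_concat, hw, List.range_succ (n := n + 1), List.map_append]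
    rfl

/-- A sequence of consecutively adjacent vertices, as long as the number of vertices, that meets
every vertex gives a Hamilton path. -/
theorem hasHamiltonPath_of_sequence [Fintype V] [DecidableEq V] (X : SimpleGraph V) (f : ℕ → V)
    {n : ℕ} (hn : Fintype.card V = n) (hadj : ∀ k, k + 1 < n → X.Adj (f k) (f (k + 1)))
    (hsurj : ∀ v, ∃ k < n, f k = v) (hpos : 0 < n) : HasHamiltonPath X := by
  obtain ⟨m, rfl⟩ : ∃ m, n = m + 1 := ⟨n - 1, by omega⟩
  obtain ⟨w, hw⟩ := exists_walk_support_eq_map_range X f m fun k hk => hadj k (by omega)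
  -- A surjection between finite sets of equal size is injective, so no vertex repeats.
  have hbij : Function.Bijective (fun k : Fin (m + 1) => f k) := by
    rw [Fintype.bijective_iff_surjective_and_card]
    refine ⟨fun v => ?_, by simp [hn]⟩
    obtain ⟨k, hk, rfl⟩ := hsurj v
    exact ⟨⟨k, hk⟩, rfl⟩
  have hnodup : ((List.range (m + 1)).map f).Nodup := by
    refine List.Nodup.map_on (fun x hx y hy hxy => ?_) List.nodup_range
    have := @hbij.1 ⟨x, List.mem_range.1 hx⟩ ⟨y, List.mem_range.1 hy⟩ hxy
    exact congrArg Fin.val this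
  refine ⟨_, _, w, fun v => ?_⟩
  rw [hw]
  obtain ⟨k, hk, rfl⟩ := hsurj v
  exact List.count_eq_one_of_mem hnodup (List.mem_map.2 ⟨k, List.mem_range.2 hk, rfl⟩)

theorem adj_div_mod_succ (X : SimpleGraph V) (F : ℕ → ℕ → V) (m L : ℕ) (hL : 0 < L)
    (hin : ∀ k < m, ∀ i, i + 1 < L → X.Adj (F k i) (F k (i + 1)))
    (hout : ∀ k, k + 1 < m → X.Adj (F k (L - 1)) (F (k + 1) 0)) (n : ℕ) (hn : n + 1 < m * L) :
    X.Adj (F (n / L) (n % L)) (F ((n + 1) / L) ((n + 1) % L)) := by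
  have hmod := Nat.mod_lt n hL
  have hdiv : (n + 1) / L < m := Nat.div_lt_of_lt_mul (by rwa [mul_comm])
  have hle : n / L ≤ (n + 1) / L := Nat.div_le_div_right (by omega)
  have hdm := Nat.div_add_mod n L
  by_cases h : n % L + 1 < L
  · obtain ⟨h1, h2⟩ := (Nat.div_mod_unique (a := n + 1) (d := n / L) (c := n % L + 1) hL).2
      ⟨by omega, h⟩
    rw [h1, h2]
    exact hin _ (by omega) _ h
  · have h0 : n % L = L - 1 := by omega
    have h3 : n + 1 = L * (n / L + 1) := by rw [mul_add]; omega
    have h1 : (n + 1) / L = n / L + 1 := by rw [h3, Nat.mul_div_cancel_left _ hL]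
    have h2 : (n + 1) % L = 0 := by rw [h3, Nat.mul_mod_right]
    rw [h0, h1, h2]
    exact hout _ (by omega)

/-- Paths of the same length, each of which ends next to the beginning of the following one, join
to a Hamilton path if together they meet every vertex. -/
theorem hasHamiltonPath_of_segments [Fintype V] [DecidableEq V] (X : SimpleGraph V)
    (F : ℕ → ℕ → V) (m L : ℕ) (hL : 0 < L) (hm : 0 < m) (hcard : Fintype.card V = m * L)
    (hin : ∀ k < m, ∀ i, i + 1 < L → X.Adj (F k i) (F k (i + 1)))
    (hout : ∀ k, k + 1 < m → X.Adj (F k (L - 1)) (F (k + 1) 0))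
    (hsurj : ∀ v, ∃ k < m, ∃ i < L, F k i = v) : HasHamiltonPath X := by
  refine hasHamiltonPath_of_sequence X (fun n => F (n / L) (n % L)) hcard
    (adj_div_mod_succ X F m L hL hin hout) (fun v => ?_) (Nat.mul_pos hm hL)
  obtain ⟨k, hk, i, hi, rfl⟩ := hsurj v
  refine ⟨k * L + i, by nlinarith, ?_⟩
  obtain ⟨h1, h2⟩ := (Nat.div_mod_unique (a := k * L + i) (d := k) (c := i) hL).2
    ⟨by rw [mul_comm L, add_comm], hi⟩
  simp only [h1, h2]

theorem eq_of_connected_of_adj {X : SimpleGraph V} (hX : X.Connected) {T : Type*} (f : V → T)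
    (hf : ∀ v w, X.Adj v w → f v = f w) (v w : V) : f v = f w := by
  obtain ⟨u⟩ := hX.preconnected v w
  induction u with
  | nil => rfl
  | cons h _ ih => exact (hf _ _ h).trans ih

/-! ### A semiregular automorphism of order `p` -/

section PGroup

variable {V N : Type*} [Group N] [Finite N] [MulAction N V] {p : ℕ} [Fact p.Prime]

open MulAction

/-- The index is a power of `p` that is at most `2p < p ^ 2`. It is not 1, since otherwise `P` lies
in the stabilizer of `v` in `N`, of index `2p`, while `p` does not divide the index of `P`. -/
theorem index_stabilizer_sylow_eq_prime (hp : 2 < p) (P : Sylow p N) (v : V)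
    (hv : (orbit N v).ncard = 2 * p) : (stabilizer P v).index = p := by
  have hpp : p.Prime := Fact.out
  obtain ⟨k, hk⟩ := P.2.index (stabilizer P v)
  have hle : (stabilizer P v).index ≤ 2 * p := by
    rw [index_stabilizer, ← hv]
    refine Set.ncard_le_ncard ?_ (Set.finite_range _)
    rintro _ ⟨g, rfl⟩
    exact ⟨g.1, rfl⟩
  have hk0 : k ≠ 0 := by
    rintro rfl
    rw [pow_zero, Subgroup.index_eq_one] at hk
    have hPs : P.1 ≤ stabilizer N v := fun g hg => by
      have : (⟨g, hg⟩ : P) ∈ stabilizer P v := hk ▸ Subgroup.mem_top _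
      exact this
    have := Subgroup.index_dvd_of_le hPs
    rw [index_stabilizer, hv] at this
    exact P.not_dvd_index ((dvd_mul_left p 2).trans this)
  have hk2 : k < 2 := by
    by_contra! h
    have : p ^ 2 ≤ p ^ k := Nat.pow_le_pow_right hpp.pos h
    nlinarith
  rw [hk, show k = 1 by omega, pow_one]

theorem normal_of_index_eq_prime {P : Type*} [Group P] [Finite P] (hP : IsPGroup p P)
    (K : Subgroup P) (hK : K.index = p) : K.Normal := by
  have hpp : p.Prime := Fact.out
  obtain ⟨n, hn⟩ := IsPGroup.iff_card.1 hP
  refine Subgroup.normal_of_index_eq_minFac_card ?_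
  have hn0 : n ≠ 0 := by
    rintro rfl
    have := Subgroup.index_dvd_card K
    rw [hK, hn, pow_zero] at this
    exact hpp.one_lt.ne' (Nat.dvd_one.1 this)
  rw [hK, hn, hpp.pow_minFac hn0]

theorem sup_eq_top_of_index_eq_prime {P : Type*} [Group P] {K L : Subgroup P}
    (hK : K.index = p) (hL : L.index = p) (hne : K ≠ L) : K ⊔ L = ⊤ := by
  have hpp : p.Prime := Fact.out
  have key : ∀ {A B : Subgroup P}, A.index = p → A ≤ B → B.index = p → B ≤ A := by
    intro A B hA hAB hB
    have := Subgroup.relIndex_mul_index hAB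
    rw [hA, hB] at this
    exact Subgroup.relIndex_eq_one.1 (Nat.eq_of_mul_eq_mul_right hpp.pos (by simpa using this))
  rcases (Nat.dvd_prime hpp).1 (hK ▸ Subgroup.index_dvd_of_le (le_sup_left : K ≤ K ⊔ L)) with h | h
  · exact Subgroup.index_eq_one.1 h
  · exact absurd (le_antisymm (le_sup_left.trans (key hL le_sup_right h))
      (le_sup_right.trans (key hK le_sup_left h))) hne

/-- If the orbits of a finite group of automorphisms of a graph have size `2p`, then the graph has
a semiregular automorphism of order `p` that fixes every orbit. -/
theorem exists_semiregular_of_ncard_orbit (X : SimpleGraph V) (hp : 2 < p)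
    (hadj : ∀ (g : N) v w, X.Adj v w → X.Adj (g • v) (g • w))
    (horb : ∀ v : V, (orbit N v).ncard = 2 * p) :
    ∃ α : V → V, (∀ v, α^[p] v = v) ∧ (∀ v, α v ≠ v) ∧
      (∀ v w, X.Adj v w → X.Adj (α v) (α w)) ∧ ∀ v, ∃ g : N, α v = g • v := by
  classical
  have hpp : p.Prime := Fact.out
  obtain ⟨P⟩ : Nonempty (Sylow p N) := inferInstance
  have hidx : ∀ v : V, (stabilizer P v).index = p := fun v =>
    index_stabilizer_sylow_eq_prime hp P v (horb v)
  have hnorm : ∀ v : V, (stabilizer P v).Normal := fun v =>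
    normal_of_index_eq_prime P.2 _ (hidx v)
  have hstab : ∀ (g : P) (v : V), stabilizer P (g • v) = stabilizer P v := by
    intro g v
    ext h
    rw [mem_stabilizer_iff, mem_stabilizer_iff, smul_smul, ← inv_smul_eq_iff, smul_smul,
      ← mem_stabilizer_iff, ← mem_stabilizer_iff, ← mul_assoc]
    constructor
    · intro hh
      have := (hnorm v).conj_mem _ hh g
      simpa [mul_assoc] using this
    · intro hh
      have := (hnorm v).conj_mem _ hh g⁻¹
      simpa [mul_assoc] using this
  -- The element is chosen from the subgroup alone, so that vertices with equal stabilizers are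
  -- moved by the same element.
  have hc : ∀ K : Subgroup P, ∃ g : P, K ≠ ⊤ → g ∉ K := by
    intro K
    by_cases hK : K = ⊤
    · exact ⟨1, fun h => absurd hK h⟩
    · obtain ⟨g, hg⟩ := not_forall.1 (fun h => hK ((Subgroup.eq_top_iff' K).2 h))
      exact ⟨g, fun _ => hg⟩
  choose c hc using hc
  have hcv : ∀ v : V, c (stabilizer P v) ∉ stabilizer P v := fun v => by
    refine hc _ fun h => ?_
    have := hidx v
    rw [h, Subgroup.index_top] at this
    exact hpp.one_lt.ne this
  have hPadj : ∀ (g : P) v w, X.Adj v w → X.Adj (g • v) (g • w) := fun g => hadj g.1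
  have hiter : ∀ (n : ℕ) (v : V), (fun v => c (stabilizer P v) • v)^[n] v =
      c (stabilizer P v) ^ n • v := by
    intro n
    induction n with
    | zero => intro v; simp
    | succ n ih =>
      intro v
      rw [Function.iterate_succ_apply', ih, hstab, smul_smul, pow_succ']
  refine ⟨fun v => c (stabilizer P v) • v, fun v => ?_, fun v hv => hcv v hv, fun v w hvw => ?_,
    fun v => ⟨(c (stabilizer P v)).1, rfl⟩⟩
  · rw [hiter]
    have := hnorm v
    have h := (stabilizer P v).pow_index_mem (c (stabilizer P v))
    rw [hidx v] at h
    exact h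
  · by_cases h : stabilizer P v = stabilizer P w
    · simp only [h]
      exact hPadj _ _ _ hvw
    -- Distinct normal stabilizers of index `p` have product `P`, so `v` is adjacent to the whole
    -- `P`-orbit of `w` and the two orbits may be moved independently.
    · have hall : ∀ g : P, X.Adj v (g • w) := by
        intro g
        have hg : g ∈ stabilizer P v ⊔ stabilizer P w := by
          rw [sup_eq_top_of_index_eq_prime (hidx v) (hidx w) h]
          exact Subgroup.mem_top _
        have := hnorm v
        obtain ⟨a, ha, b, hb, rfl⟩ := Subgroup.mem_sup_of_normal_left.1 hg
        rw [mul_smul, mem_stabilizer_iff.1 hb]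
        have := hPadj a _ _ hvw
        rwa [mem_stabilizer_iff.1 ha] at this
      have := hPadj (c (stabilizer P v)) _ _
        (hall ((c (stabilizer P v))⁻¹ * c (stabilizer P w)))
      rwa [smul_smul, mul_inv_cancel_left] at this

end PGroup

/-! ### Blocks and cyclic coordinates -/

theorem exists_blockMap_of_orbits {N : Type*} [Group N] [MulAction N V] [Fintype V] {m k : ℕ}
    (hk : 0 < k) (hcard : Fintype.card V = m * k)
    (horb : ∀ v : V, (MulAction.orbit N v).ncard = k) :
    ∃ b : V → Fin m, (∀ i, (b ⁻¹' {i}).ncard = k) ∧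
      ∀ v w, b v = b w ↔ v ∈ MulAction.orbit N w := by
  classical
  let Ω := MulAction.orbitRel.Quotient N V
  let π : V → Ω := Quotient.mk _
  have hπ : ∀ v w, π v = π w ↔ v ∈ MulAction.orbit N w := fun v w => by
    rw [← MulAction.orbitRel_apply]; exact Quotient.eq
  have hfib : ∀ ω : Ω, (π ⁻¹' {ω}).ncard = k := by
    intro ω
    induction ω using Quotient.inductionOn with
    | h w =>
      rw [← horb w]
      congr 1
      ext v
      exact hπ v w
  have hΩ : Fintype.card Ω = m := by
    have h := Finset.card_eq_sum_card_fiberwise (s := (Finset.univ : Finset V))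
      (t := (Finset.univ : Finset Ω)) (f := π) (fun _ _ => Finset.mem_coe.2 (Finset.mem_univ _))
    have h2 : ∀ ω : Ω, (Finset.univ.filter fun v => π v = ω).card = k := fun ω => by
      rw [← hfib ω, ← Set.ncard_coe_finset]
      congr 1
      ext v
      simp
    simp only [h2, Finset.sum_const, Finset.card_univ, hcard, smul_eq_mul] at h
    exact (Nat.eq_of_mul_eq_mul_right hk h).symm
  let ε : Ω ≃ Fin m := Fintype.equivFinOfCardEq hΩ
  refine ⟨fun v => ε (π v), fun i => ?_, fun v w => by rw [← hπ]; exact ε.injective.eq_iff⟩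
  rw [← hfib (ε.symm i)]
  congr 1
  ext v
  simp [Equiv.eq_symm_apply]

/-- Vertices as pairs of one of the `2 * 3` orbits of a semiregular automorphism and an
element of `ZMod p`, on which the automorphism acts as a shift. -/
structure CyclicCoordinates (X : SimpleGraph V) (b : V → Fin 3) (p : ℕ) where
  e : (Fin 3 × Fin 2) × ZMod p ≃ V
  adj_shift : ∀ q q' x y c, X.Adj (e (q, x)) (e (q', y)) → X.Adj (e (q, x + c)) (e (q', y + c))
  block : ∀ q x, b (e (q, x)) = q.1

theorem iterate_eq_iff_of_iterate_prime {α : V → V} {p : ℕ} (hp : p.Prime)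
    (hα : ∀ v, α^[p] v = v) (hne : ∀ v, α v ≠ v) {v : V} {x y : ℕ} (hx : x < p) (hy : y < p)
    (h : α^[x] v = α^[y] v) : x = y := by
  have hper : Function.minimalPeriod α v = p := by
    rcases (Nat.dvd_prime hp).1 (Function.IsPeriodicPt.minimalPeriod_dvd (hα v)) with h | h
    · exact absurd (Function.minimalPeriod_eq_one_iff_isFixedPt.1 h) (hne v)
    · exact h
  exact Function.iterate_injOn_Iio_minimalPeriod (f := α) (x := v) (by simpa [hper] using hx)
    (by simpa [hper] using hy) h

theorem exists_cyclicCoordinates [Fintype V] (X : SimpleGraph V) (b : V → Fin 3) {p : ℕ}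
    [Fact p.Prime] (hcard : Fintype.card V = 6 * p) (hb : ∀ i, (b ⁻¹' {i}).ncard = 2 * p)
    (α : V → V) (hα : ∀ v, α^[p] v = v) (hne : ∀ v, α v ≠ v)
    (hadj : ∀ v w, X.Adj v w → X.Adj (α v) (α w)) (hbα : ∀ v, b (α v) = b v) :
    Nonempty (CyclicCoordinates X b p) := by
  classical
  have hp : p.Prime := Fact.out
  have hbit : ∀ n v, b (α^[n] v) = b v := by
    intro n
    induction n with
    | zero => intro v; rfl
    | succ n ih => intro v; rw [Function.iterate_succ_apply', hbα, ih]
  -- Base points of the two orbits of `α` in a block: one orbit covers only `p` of the `2p`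
  -- vertices.
  have hrep : ∀ i, ∃ v : Fin 2 → V, (∀ a, b (v a) = i) ∧ ∀ n, α^[n] (v 0) ≠ v 1 := by
    intro i
    have hpos : 0 < (b ⁻¹' {i}).ncard := by rw [hb]; have := hp.pos; omega
    obtain ⟨v, hv⟩ := (Set.ncard_pos (Set.toFinite _)).1 hpos
    obtain ⟨w, hw, hw'⟩ : ∃ w ∈ b ⁻¹' {i},
        w ∉ (((Finset.range p).image fun n => α^[n] v : Finset V) : Set V) := by
      refine Set.exists_mem_notMem_of_ncard_lt_ncard ?_ (Finset.finite_toSet _)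
      rw [hb, Set.ncard_coe_finset]
      refine lt_of_le_of_lt Finset.card_image_le ?_
      rw [Finset.card_range]
      have := hp.pos
      omega
    refine ⟨![v, w], fun a => ?_, fun n hn => hw' ?_⟩
    · fin_cases a
      · exact hv
      · exact hw
    · have hn' : α^[n] v = w := hn
      rw [Finset.mem_coe, Finset.mem_image]
      refine ⟨n % p, Finset.mem_range.2 (Nat.mod_lt _ hp.pos), ?_⟩
      rw [Function.IsPeriodicPt.iterate_mod_apply (hα v), hn']
  choose rep hrepb hrepne using hrep
  let f : (Fin 3 × Fin 2) × ZMod p → V := fun z => α^[z.2.val] (rep z.1.1 z.1.2)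
  have hfb : ∀ z, b (f z) = z.1.1 := fun z => by rw [hbit, hrepb]
  have hcross : ∀ i m n, m < p → α^[m] (rep i 0) ≠ α^[n] (rep i 1) := by
    intro i m n hm h
    have h2 : α^[p * n] (rep i 1) = rep i 1 := by
      rw [Function.iterate_mul, show α^[p] = id from funext hα, Function.iterate_id, id]
    -- As `α^[p * n]` is the identity, `α^[p * n - n]` inverts `α^[n]`.
    apply hrepne i (p * n - n + m)
    rw [Function.iterate_add_apply, h, ← Function.iterate_add_apply,
      Nat.sub_add_cancel (Nat.le_mul_of_pos_left n hp.pos), h2]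
  have hinj : Function.Injective f := by
    rintro ⟨⟨i, a⟩, x⟩ ⟨⟨j, c⟩, y⟩ h
    have hij : i = j := (hfb _).symm.trans ((congrArg b h).trans (hfb _))
    subst hij
    have hx := ZMod.val_lt x
    have hy := ZMod.val_lt y
    have hac : a = c := by
      fin_cases a <;> fin_cases c
      · rfl
      · exact absurd h (hcross i _ _ hx)
      · exact absurd h.symm (hcross i _ _ hy)
      · rfl
    subst hac
    rw [ZMod.val_injective p (iterate_eq_iff_of_iterate_prime hp hα hne hx hy h)]
  have hbij : Function.Bijective f := by
    rw [Fintype.bijective_iff_injective_and_card]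
    refine ⟨hinj, ?_⟩
    simp [hcard, ZMod.card]
  have hsucc : ∀ q x, f (q, x + 1) = α (f (q, x)) := by
    intro q x
    simp only [f, ← Function.iterate_succ_apply' α]
    rw [ZMod.val_add, ZMod.val_one, Function.IsPeriodicPt.iterate_mod_apply (hα _)]
  have hshift : ∀ (n : ℕ) q q' x y, X.Adj (f (q, x)) (f (q', y)) →
      X.Adj (f (q, x + n)) (f (q', y + n)) := by
    intro n
    induction n with
    | zero => intro q q' x y h; simpa using h
    | succ n ih =>
      intro q q' x y h
      rw [Nat.cast_succ, ← add_assoc, ← add_assoc, hsucc, hsucc]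
      exact hadj _ _ (ih _ _ _ _ h)
  refine ⟨⟨Equiv.ofBijective f hbij, fun q q' x y c h => ?_, fun q x => hfb (q, x)⟩⟩
  have := hshift c.val q q' x y h
  rwa [ZMod.natCast_zmod_val] at this

/-- The block structure on the graph given by genuine imprimitivity with three blocks of size
`2p`. -/
theorem exists_blockMap_of_isGenuinelyImprimitiveWith [Fintype V] (X : SimpleGraph V) {p : ℕ}
    (hp : p.Prime) (hp2 : 2 < p) (hcard : Fintype.card V = 6 * p) (ℬ : Set (Set V))
    (hℬ : IsGenuinelyImprimitiveWith X ℬ) (hsize : ∀ B ∈ ℬ, B.ncard = 2 * p) :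
    ∃ b : V → Fin 3, (∀ v w, b v = b w → ∃ g : X ≃g X, g v = w ∧ ∀ u, b (g u) = b u) ∧
      (∀ v w, ∃ g : X ≃g X, g v = w ∧ ∀ x y, b (g x) = b (g y) ↔ b x = b y) ∧
      Nonempty (CyclicCoordinates X b p) := by
  obtain ⟨G, hblock, N, hN, rfl⟩ := hℬ
  have : Fact p.Prime := ⟨hp⟩
  have : Finite (X ≃g X) := Finite.of_injective (fun g => (g : V → V)) DFunLike.coe_injective
  have horb : ∀ v : V, (MulAction.orbit N v).ncard = 2 * p := fun v => hsize _ ⟨v, rfl⟩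
  obtain ⟨b, hb, hbo⟩ := exists_blockMap_of_orbits (N := N) (m := 3) (k := 2 * p)
    (by omega) (by omega) horb
  have hact : ∀ (n : N) (v : V), n • v = (n.1.1 : X ≃g X) v := fun _ _ => rfl
  have hbN : ∀ (n : N) (v : V), b (n • v) = b v := fun n v => (hbo _ _).2 ⟨n, rfl⟩
  refine ⟨b, fun v w hvw => ?_, fun v w => ?_, ?_⟩
  · obtain ⟨n, hn⟩ := (hbo _ _).1 hvw.symm
    exact ⟨n.1.1, hn, fun u => hbN n u⟩
  · have := hblock.transitive
    obtain ⟨g, hg⟩ := this.exists_smul_eq v w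
    -- Normality of `N` makes `G` permute the orbits of `N`.
    have hstep : ∀ (g : G) x y, b x = b y → b (g • x) = b (g • y) := by
      intro g x y hxy
      obtain ⟨n, rfl⟩ := (hbo _ _).1 hxy
      refine (hbo _ _).2 ⟨⟨g * n.1 * g⁻¹, hN.conj_mem _ n.2 g⟩, ?_⟩
      change (g * n.1 * g⁻¹) • g • y = g • n.1 • y
      rw [smul_smul, inv_mul_cancel_right, mul_smul]
    refine ⟨g.1, hg, fun x y => ⟨fun h => ?_, fun h => hstep g x y h⟩⟩
    have := hstep g⁻¹ (g • x) (g • y) h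
    rwa [inv_smul_smul, inv_smul_smul] at this
  · obtain ⟨α, h1, h2, h3, h4⟩ := exists_semiregular_of_ncard_orbit (N := N) (p := p) X hp2
      (fun g v w h => (SimpleGraph.Iso.map_adj_iff g.1.1).2 h) horb
    refine exists_cyclicCoordinates X b hcard hb α h1 h2 h3 fun v => ?_
    obtain ⟨n, hn⟩ := h4 v
    rw [hn, hbN]

/-! ### The quotient: multiplicities and valencies -/

namespace CyclicCoordinates

variable {X : SimpleGraph V} {b : V → Fin 3} {p : ℕ}

/-- `C.Step q q' t` means that every vertex `(q, x)` is adjacent to `(q', x + t)`. -/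
def Step (C : CyclicCoordinates X b p) (q q' : Fin 3 × Fin 2) (t : ZMod p) : Prop :=
  X.Adj (C.e (q, 0)) (C.e (q', t))

/-- The number of neighbours that a vertex with first coordinate `q` has among the vertices with
first coordinate `q'`. -/
noncomputable def mult (C : CyclicCoordinates X b p) (q q' : Fin 3 × Fin 2) : ℕ :=
  {t | C.Step q q' t}.ncard

/-- Renaming of the two orbits in each block. -/
def relabel (C : CyclicCoordinates X b p) (σ : Fin 3 → Equiv.Perm (Fin 2)) :
    CyclicCoordinates X b p where
  e := ((Equiv.prodShear (Equiv.refl (Fin 3)) σ).prodCongr (Equiv.refl (ZMod p))).trans C.e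
  adj_shift q q' x y c h := C.adj_shift (q.1, σ q.1 q.2) (q'.1, σ q'.1 q'.2) x y c h
  block q x := C.block (q.1, σ q.1 q.2) x

variable (C : CyclicCoordinates X b p)

theorem adj_iff_step (q q' : Fin 3 × Fin 2) (x y : ZMod p) :
    X.Adj (C.e (q, x)) (C.e (q', y)) ↔ C.Step q q' (y - x) := by
  constructor
  · intro h
    have := C.adj_shift q q' x y (-x) h
    rwa [add_neg_cancel, ← sub_eq_add_neg] at this
  · intro h
    have := C.adj_shift q q' 0 (y - x) x h
    rwa [zero_add, sub_add_cancel] at this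

variable {C}

theorem Step.symm {q q' : Fin 3 × Fin 2} {t : ZMod p} (h : C.Step q q' t) :
    C.Step q' q (-t) := by
  have := ((C.adj_iff_step q q' 0 t).2 (by rwa [sub_zero])).symm
  rwa [adj_iff_step, zero_sub] at this

theorem Step.ne_zero {q : Fin 3 × Fin 2} {t : ZMod p} (h : C.Step q q t) : t ≠ 0 := by
  rintro rfl
  exact X.irrefl h

theorem Step.adj {q q' : Fin 3 × Fin 2} {t : ZMod p} (h : C.Step q q' t) {x y : ZMod p}
    (hxy : y = x + t) : X.Adj (C.e (q, x)) (C.e (q', y)) :=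
  (C.adj_iff_step q q' x y).2 (by rwa [hxy, add_sub_cancel_left])

variable (C)

theorem mult_comm (q q' : Fin 3 × Fin 2) : C.mult q q' = C.mult q' q := by
  have : {t | C.Step q q' t} = Neg.neg '' {t | C.Step q' q t} := by
    ext t
    constructor
    · exact fun h => ⟨-t, h.symm, neg_neg t⟩
    · rintro ⟨s, hs, rfl⟩
      exact Step.symm hs
  rw [mult, mult, this, Set.ncard_image_of_injective _ neg_injective]

/-- The 2 × 2 matrix of multiplicities between two blocks has all row and column sums equal to `d`.
-/
theorem mult_one_eq {d : ℕ}
    (hd : ∀ i j a, i ≠ j → C.mult (i, a) (j, 0) + C.mult (i, a) (j, 1) = d) {i j : Fin 3}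
    (hij : i ≠ j) :
    C.mult (i, 1) (j, 0) = C.mult (i, 0) (j, 1) ∧ C.mult (i, 1) (j, 1) = C.mult (i, 0) (j, 0) := by
  have h1 := hd i j 0 hij
  have h2 := hd i j 1 hij
  have h3 := hd j i 0 hij.symm
  rw [C.mult_comm (j, 0), C.mult_comm (j, 0)] at h3
  omega

/-- The orbits can be named so that matching orbits of consecutive blocks are joined by at least as
many edges as other ones. -/
theorem exists_mult_le (C₀ : CyclicCoordinates X b p) : ∃ C : CyclicCoordinates X b p,
    C.mult (0, 0) (1, 1) ≤ C.mult (0, 0) (1, 0) ∧ C.mult (1, 0) (2, 1) ≤ C.mult (1, 0) (2, 0) := by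
  have key : ∀ f : Fin 2 → ℕ, ∃ σ : Equiv.Perm (Fin 2), f (σ 1) ≤ f (σ 0) := by
    intro f
    rcases le_total (f 1) (f 0) with h | h
    · exact ⟨Equiv.refl _, h⟩
    · exact ⟨Equiv.swap 0 1, by simpa using h⟩
  obtain ⟨σ, hσ⟩ := key fun a => C₀.mult (0, 0) (1, a)
  obtain ⟨τ, hτ⟩ := key fun a => C₀.mult (1, σ 0) (2, a)
  exact ⟨C₀.relabel ![Equiv.refl _, σ, τ], hσ, hτ⟩

variable [Fact p.Prime]

theorem mult_pos_iff {q q' : Fin 3 × Fin 2} : 0 < C.mult q q' ↔ ∃ t, C.Step q q' t :=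
  Set.ncard_pos (Set.toFinite _)

theorem not_step_of_mult_eq_zero {q q' : Fin 3 × Fin 2} (h : C.mult q q' = 0) (t : ZMod p) :
    ¬ C.Step q q' t := fun ht => ((C.mult_pos_iff).2 ⟨t, ht⟩).ne' h

theorem one_lt_mult_iff {q q' : Fin 3 × Fin 2} :
    1 < C.mult q q' ↔ ∃ s t, C.Step q q' s ∧ C.Step q q' t ∧ s ≠ t := by
  rw [mult, Set.one_lt_ncard_iff (Set.toFinite _)]
  rfl

/-- The set of steps inside an orbit is closed under negation and omits 0; as `p` is odd, it cannot
have exactly one element. -/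
theorem mult_self_eq_zero_or (hp : 2 < p) (q : Fin 3 × Fin 2) :
    C.mult q q = 0 ∨ 1 < C.mult q q := by
  rcases Nat.eq_zero_or_pos (C.mult q q) with h | h
  · exact Or.inl h
  · obtain ⟨t, ht⟩ := C.mult_pos_iff.1 h
    refine Or.inr (C.one_lt_mult_iff.2 ⟨t, -t, ht, ht.symm, fun h => ht.ne_zero ?_⟩)
    by_contra h0
    exact ZMod.ne_neg_self ((Fact.out : p.Prime).odd_of_ne_two hp.ne') h0 h

theorem ncard_neighbors_block (q : Fin 3 × Fin 2) (j : Fin 3) :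
    {w | X.Adj (C.e (q, 0)) w ∧ b w = j}.ncard = C.mult q (j, 0) + C.mult q (j, 1) := by
  have hset : {w | X.Adj (C.e (q, 0)) w ∧ b w = j} =
      (fun t => C.e ((j, 0), t)) '' {t | C.Step q (j, 0) t} ∪
        (fun t => C.e ((j, 1), t)) '' {t | C.Step q (j, 1) t} := by
    ext w
    constructor
    · rintro ⟨h1, h2⟩
      obtain ⟨⟨⟨i, a⟩, t⟩, rfl⟩ := C.e.surjective w
      rw [C.block] at h2
      obtain rfl : i = j := h2
      fin_cases a
      · exact Or.inl ⟨t, h1, rfl⟩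
      · exact Or.inr ⟨t, h1, rfl⟩
    · rintro (⟨t, ht, rfl⟩ | ⟨t, ht, rfl⟩) <;> exact ⟨ht, C.block _ _⟩
  have hinj : ∀ a : Fin 2, Function.Injective fun t => C.e ((j, a), t) := fun a x y h => by
    have := C.e.injective h
    exact (Prod.ext_iff.1 this).2
  rw [hset, Set.ncard_union_eq ?_ (Set.toFinite _) (Set.toFinite _),
    Set.ncard_image_of_injective _ (hinj 0), Set.ncard_image_of_injective _ (hinj 1)]
  · rfl
  · rw [Set.disjoint_left]
    rintro _ ⟨s, -, rfl⟩ ⟨t, -, h⟩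
    have := C.e.injective h
    simp at this

/-- All the vertices have the same number of neighbours in their own block, and the same number of
neighbours in each other block. -/
theorem exists_valencies
    (hN : ∀ v w, b v = b w → ∃ g : X ≃g X, g v = w ∧ ∀ u, b (g u) = b u)
    (hG : ∀ v w, ∃ g : X ≃g X, g v = w ∧ ∀ x y, b (g x) = b (g y) ↔ b x = b y) :
    ∃ d r, (∀ i j a, i ≠ j → C.mult (i, a) (j, 0) + C.mult (i, a) (j, 1) = d) ∧
      ∀ i a, C.mult (i, a) (i, 0) + C.mult (i, a) (i, 1) = r := by
  have hdeg : ∀ (g : X ≃g X) v j k, (∀ w, b w = j ↔ b (g w) = k) →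
      {w | X.Adj (g v) w ∧ b w = k}.ncard = {w | X.Adj v w ∧ b w = j}.ncard := by
    intro g v j k h
    rw [← Set.ncard_image_of_injective {w | X.Adj v w ∧ b w = j} g.injective]
    congr 1
    ext w
    constructor
    · rintro ⟨h1, h2⟩
      obtain ⟨u, rfl⟩ := g.surjective w
      exact ⟨u, ⟨g.map_adj_iff.1 h1, (h u).2 h2⟩, rfl⟩
    · rintro ⟨u, ⟨h1, h2⟩, rfl⟩
      exact ⟨g.map_adj_iff.2 h1, (h u).1 h2⟩
  let D : Fin 3 → Fin 3 → ℕ := fun i j => {w | X.Adj (C.e ((i, 0), 0)) w ∧ b w = j}.ncard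
  have hD : ∀ v j, {w | X.Adj v w ∧ b w = j}.ncard = D (b v) j := by
    intro v j
    obtain ⟨g, hgv, hg⟩ := hN (C.e ((b v, 0), 0)) v (C.block _ _)
    have := hdeg g (C.e ((b v, 0), 0)) j j fun w => by rw [hg]
    rwa [hgv] at this
  have hm : ∀ i a j, C.mult (i, a) (j, 0) + C.mult (i, a) (j, 1) = D i j := by
    intro i a j
    rw [← ncard_neighbors_block, hD, C.block]
  have hsymm : ∀ i j, D i j = D j i := by
    intro i j
    have h1 := hm i 0 j
    have h2 := hm i 1 j
    have h3 := hm j 0 i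
    have h4 := hm j 1 i
    rw [C.mult_comm (j, _)] at h3 h4
    rw [C.mult_comm (j, _) (i, 1)] at h3 h4
    omega
  -- The action on the blocks is transitive and preserves the symmetric matrix `D`; on three blocks
  -- this makes all off-diagonal entries equal.
  have hperm : ∀ k, ∃ π : Fin 3 → Fin 3, π 0 = k ∧ Function.Injective π ∧
      ∀ i j, D (π i) (π j) = D i j := by
    intro k
    obtain ⟨g, hg, hgb⟩ := hG (C.e ((0, 0), 0)) (C.e ((k, 0), 0))
    refine ⟨fun i => b (g (C.e ((i, 0), 0))), ?_, fun i j h => ?_, fun i j => ?_⟩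
    · simp only [hg, C.block]
    · have := (hgb _ _).1 h
      rwa [C.block, C.block] at this
    · rw [← hD]
      refine hdeg g _ _ _ fun w => ?_
      rw [hgb, C.block]
  refine ⟨D 0 1, D 0 0, fun i j a hij => (hm i a j).trans ?_, fun i a => (hm i a i).trans ?_⟩
  · obtain ⟨π, h0, hinj, hπ⟩ := hperm 1
    obtain ⟨τ, k0, kinj, hτ⟩ := hperm 2
    have e1 := hπ 0 1
    have e2 := hπ 0 2
    have e3 := hτ 0 1
    have e4 := hτ 0 2
    have n1 := hinj.ne (show (0 : Fin 3) ≠ 1 by decide)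
    have n2 := hinj.ne (show (0 : Fin 3) ≠ 2 by decide)
    have n3 := hinj.ne (show (1 : Fin 3) ≠ 2 by decide)
    have m1 := kinj.ne (show (0 : Fin 3) ≠ 1 by decide)
    have m2 := kinj.ne (show (0 : Fin 3) ≠ 2 by decide)
    have m3 := kinj.ne (show (1 : Fin 3) ≠ 2 by decide)
    rw [h0] at e1 e2 n1 n2
    rw [k0] at e3 e4 m1 m2
    have s1 := hsymm 0 1
    have s2 := hsymm 0 2
    have s3 := hsymm 1 2
    generalize π 1 = π1 at *
    generalize π 2 = π2 at *
    generalize τ 1 = τ1 at *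
    generalize τ 2 = τ2 at *
    have hall : D 0 2 = D 0 1 ∧ D 1 2 = D 0 1 := by
      have c1 : (π1 = 0 ∧ π2 = 2) ∨ (π1 = 2 ∧ π2 = 0) := by
        revert n1 n2 n3; clear * -; decide +revert
      have c2 : (τ1 = 0 ∧ τ2 = 1) ∨ (τ1 = 1 ∧ τ2 = 0) := by
        revert m1 m2 m3; clear * -; decide +revert
      rcases c1 with ⟨rfl, rfl⟩ | ⟨rfl, rfl⟩ <;> rcases c2 with ⟨rfl, rfl⟩ | ⟨rfl, rfl⟩ <;> omega
    obtain ⟨g1, g2⟩ := hall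
    fin_cases i <;> fin_cases j <;>
      first
      | exact absurd rfl hij
      | (simp only [Fin.reduceFinMk, Fin.mk_one, Fin.zero_eta]; try omega)
  · obtain ⟨π, h0, -, hπ⟩ := hperm i
    rw [← h0, hπ]

/-- The coordinates of a connected graph do not have a potential. -/
theorem false_of_potential (hX : X.Connected) (φ : Fin 3 × Fin 2 → ZMod p)
    (hφ : ∀ q q' t, C.Step q q' t → t = φ q' - φ q) : False := by
  -- The function `x - φ q` is constant along edges, yet takes different values at two vertices of
  -- one orbit.
  have h := eq_of_connected_of_adj hX
    (fun v => (C.e.symm v).2 - φ (C.e.symm v).1) (fun v w hvw => by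
      obtain ⟨⟨q, x⟩, rfl⟩ := C.e.surjective v
      obtain ⟨⟨q', y⟩, rfl⟩ := C.e.surjective w
      have := hφ _ _ _ ((C.adj_iff_step _ _ _ _).1 hvw)
      simp only [Equiv.symm_apply_apply]
      linear_combination -this) (C.e (0, 0)) (C.e (0, 1))
  simp only [Equiv.symm_apply_apply] at h
  exact zero_ne_one (sub_left_injective h)

/-- Connectedness of the quotient, in the form used to rule out quotients that split. -/
theorem invariant_const (hX : X.Connected) {T : Type*} (f : Fin 3 × Fin 2 → T)
    (hf : ∀ q q' t, C.Step q q' t → f q = f q') (q q' : Fin 3 × Fin 2) : f q = f q' := by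
  have h := eq_of_connected_of_adj hX
    (fun v => f (C.e.symm v).1) (fun v w hvw => by
      obtain ⟨⟨q, x⟩, rfl⟩ := C.e.surjective v
      obtain ⟨⟨q', y⟩, rfl⟩ := C.e.surjective w
      have := hf _ _ _ ((C.adj_iff_step _ _ _ _).1 hvw)
      simpa only [Equiv.symm_apply_apply] using this) (C.e (q, 0)) (C.e (q', 0))
  simpa using h

theorem valency_pos (hX : X.Connected) {d : ℕ}
    (hd : ∀ i j a, i ≠ j → C.mult (i, a) (j, 0) + C.mult (i, a) (j, 1) = d) : 0 < d := by
  by_contra! h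
  have := C.invariant_const hX Prod.fst (fun q q' t ht => by
    obtain ⟨i, a⟩ := q
    obtain ⟨j, c⟩ := q'
    by_contra hij
    have h1 := hd i j a hij
    have h2 := C.mult_pos_iff.2 ⟨t, ht⟩
    fin_cases c <;> simp at h2 <;> omega) (0, 0) (1, 0)
  simp at this

end CyclicCoordinates

/-! ### Lifting walks of the quotient -/

theorem sum_range_mul_add {M : Type*} [AddCommMonoid M] {m : ℕ} (s : ℕ → M)
    (hs : ∀ n, s (n + m) = s n) (k i : ℕ) :
    ∑ j ∈ Finset.range (m * k + i), s j =
      k • ∑ j ∈ Finset.range m, s j + ∑ j ∈ Finset.range i, s j := by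
  have hper : ∀ k j, s (m * k + j) = s j := by
    intro k
    induction k with
    | zero => intro j; rw [mul_zero, zero_add]
    | succ k ih => intro j; rw [mul_add, mul_one, add_right_comm, hs, ih]
  have hmul : ∀ k, ∑ j ∈ Finset.range (m * k), s j = k • ∑ j ∈ Finset.range m, s j := by
    intro k
    induction k with
    | zero => simp
    | succ k ih => simp only [mul_add, mul_one, Finset.sum_range_add, ih, hper, succ_nsmul]
  simp only [Finset.sum_range_add, hmul, hper]

/-- Partial sums of a periodic sequence whose sum over a period does not vanish. -/
theorem exists_partial_sum_eq {Q : Type*} {p : ℕ} [Fact p.Prime] {m : ℕ} (q : ℕ → Q)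
    (s : ℕ → ZMod p) (hq : ∀ n, q (n + m) = q n) (hs : ∀ n, s (n + m) = s n)
    (hsum : ∑ j ∈ Finset.range m, s j ≠ 0) (x₀ x : ZMod p) {i : ℕ} (hi : i < m) :
    ∃ n < m * p, q n = q i ∧ x₀ + ∑ j ∈ Finset.range n, s j = x := by
  -- `c` is the number of full turns after which `i` further steps lead to `x`.
  obtain ⟨c, hc⟩ : ∃ c : ZMod p, c * ∑ j ∈ Finset.range m, s j =
      x - x₀ - ∑ j ∈ Finset.range i, s j := ⟨_, div_mul_cancel₀ _ hsum⟩
  have hper : ∀ k, q (m * k + i) = q i := by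
    intro k
    induction k with
    | zero => rw [mul_zero, zero_add]
    | succ k ih => rw [mul_add, mul_one, add_right_comm, hq, ih]
  refine ⟨m * c.val + i, ?_, hper _, ?_⟩
  · have := ZMod.val_lt c
    nlinarith
  · rw [sum_range_mul_add s hs, nsmul_eq_mul, ZMod.natCast_zmod_val, hc]
    ring

namespace CyclicCoordinates

variable {X : SimpleGraph V} {b : V → Fin 3} {p : ℕ} [Fact p.Prime]
  (C : CyclicCoordinates X b p)

/-- The lift of a closed walk of length `m` in the quotient. -/
def lift {m : ℕ} [NeZero m] (q : Fin m → Fin 3 × Fin 2) (s : Fin m → ZMod p) (x₀ : ZMod p)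
    (n : ℕ) : V :=
  C.e (q (Fin.ofNat m n), x₀ + ∑ j ∈ Finset.range n, s (Fin.ofNat m j))

variable {m : ℕ} [NeZero m] (q : Fin m → Fin 3 × Fin 2) (s : Fin m → ZMod p) (x₀ : ZMod p)

theorem adj_lift_succ (hs : ∀ i, C.Step (q i) (q (i + 1)) (s i)) (n : ℕ) :
    X.Adj (C.lift q s x₀ n) (C.lift q s x₀ (n + 1)) := by
  have h := hs (Fin.ofNat m n)
  have h1 : Fin.ofNat m n + 1 = Fin.ofNat m (n + 1) := by
    apply Fin.ext
    rw [Fin.val_add, Fin.val_one', Fin.val_ofNat, Fin.val_ofNat, ← Nat.add_mod]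
  rw [h1] at h
  exact h.adj (by rw [Finset.sum_range_succ, add_assoc])

theorem exists_lift_eq (hsum : ∑ i, s i ≠ 0) (i : Fin m) (x : ZMod p) :
    ∃ n < m * p, C.lift q s x₀ n = C.e (q i, x) := by
  have hper : ∀ n, Fin.ofNat m (n + m) = Fin.ofNat m n := fun n => by
    apply Fin.ext
    rw [Fin.val_ofNat, Fin.val_ofNat, Nat.add_mod_right]
  have hi : Fin.ofNat m i.val = i := by simp [Fin.ofNat_eq_cast]
  obtain ⟨n, hn, h1, h2⟩ := exists_partial_sum_eq (m := m) (p := p)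
    (fun n => q (Fin.ofNat m n)) (fun n => s (Fin.ofNat m n))
    (fun n => by rw [hper]) (fun n => by rw [hper])
    (by
      rw [← Fin.sum_univ_eq_sum_range (fun n => s (Fin.ofNat m n)) m]
      convert hsum using 3 with j
      simp [Fin.ofNat_eq_cast]) x₀ x i.2
  refine ⟨n, hn, ?_⟩
  rw [lift, h1, h2, hi]

theorem card_eq (C : CyclicCoordinates X b p) [Fintype V] : Fintype.card V = 6 * p := by
  rw [← Fintype.card_congr C.e]
  simp [ZMod.card]

variable [Fintype V] [DecidableEq V]

/-- A Hamilton cycle of the quotient whose steps do not add up to `0` lifts to a Hamilton path. -/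
theorem hasHamiltonPath_of_cycle (q : Fin 6 → Fin 3 × Fin 2) (s : Fin 6 → ZMod p)
    (hq : Function.Surjective q) (hs : ∀ i, C.Step (q i) (q (i + 1)) (s i))
    (hsum : ∑ i, s i ≠ 0) : HasHamiltonPath X := by
  refine hasHamiltonPath_of_sequence X (C.lift q s 0) C.card_eq
    (fun n _ => C.adj_lift_succ q s 0 hs n) (fun v => ?_)
    (by have := (Fact.out : p.Prime).pos; omega)
  obtain ⟨⟨u, x⟩, rfl⟩ := C.e.surjective v
  obtain ⟨i, rfl⟩ := hq u
  exact C.exists_lift_eq q s 0 hsum i x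

/-- A Hamilton path of the quotient lifts to a Hamilton path if every orbit induces a graph that
is not empty. -/
theorem hasHamiltonPath_of_path (q : ℕ → Fin 3 × Fin 2) (hq : ∀ u, ∃ k < 6, q k = u)
    (hstep : ∀ k < 5, ∃ t, C.Step (q k) (q (k + 1)) t) (hself : ∀ u, ∃ s, C.Step u u s) :
    HasHamiltonPath X := by
  have hp : p.Prime := Fact.out
  choose s hs using hself
  have ht : ∃ t : ℕ → ZMod p, ∀ k < 5, C.Step (q k) (q (k + 1)) (t k) := by
    choose! t ht using hstep
    exact ⟨t, ht⟩
  obtain ⟨t, ht⟩ := ht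
  -- Traversing an orbit takes `p - 1` steps `s`, a total shift of `-s`; then `t` leads to the next
  -- orbit.
  let x : ℕ → ZMod p := fun k => ∑ j ∈ Finset.range k, (t j - s (q j))
  refine hasHamiltonPath_of_segments X (fun k i => C.e (q k, x k + i * s (q k))) 6 p hp.pos
    (by norm_num) C.card_eq (fun k _ i _ => (hs (q k)).adj (by push_cast; ring))
    (fun k hk => (ht k (by omega)).adj ?_) (fun v => ?_)
  · simp only [x, Finset.sum_range_succ, Nat.cast_sub hp.one_le, CharP.cast_eq_zero]
    push_cast
    ring
  · obtain ⟨⟨u, y⟩, rfl⟩ := C.e.surjective v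
    obtain ⟨k, hk, rfl⟩ := hq u
    have hne := (hs (q k)).ne_zero
    refine ⟨k, hk, ((y - x k) / s (q k)).val, ZMod.val_lt _, ?_⟩
    simp only [ZMod.natCast_zmod_val]
    rw [div_mul_cancel₀ _ hne, add_sub_cancel]

/-- If the two orbits in one block are joined by at least two edges at each vertex, then the
graphs induced by the blocks have Hamilton paths, and these can be joined. -/
theorem hasHamiltonPath_of_one_lt_mult {i : Fin 3} (hi : 1 < C.mult (i, 0) (i, 1))
    (hG : ∀ v w, ∃ g : X ≃g X, g v = w ∧ ∀ x y, b (g x) = b (g y) ↔ b x = b y)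
    (hcross : ∀ (u : Fin 3 × Fin 2) j, u.1 ≠ j → ∃ a t, C.Step u (j, a) t) :
    HasHamiltonPath X := by
  have hp : p.Prime := Fact.out
  obtain ⟨s, t, hs, ht, hst⟩ := C.one_lt_mult_iff.1 hi
  -- A closed walk of length two, out by `s` and back by `t`, with sum `s - t ≠ 0`: it lifts to a
  -- Hamilton cycle of the block.
  let h := C.lift ![(i, 0), (i, 1)] ![s, -t] 0
  have hadj : ∀ n, X.Adj (h n) (h (n + 1)) := C.adj_lift_succ _ _ _ (by
    intro k
    fin_cases k
    · exact hs
    · exact ht.symm)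
  have hb : ∀ n, b (h n) = i := fun n => by
    have : ∀ k : Fin 2, ((![(i, 0), (i, 1)] : Fin 2 → Fin 3 × Fin 2) k).1 = i := by
      intro k
      fin_cases k <;> rfl
    exact (C.block _ _).trans (this _)
  have hsurj : ∀ v, b v = i → ∃ n < 2 * p, h n = v := by
    intro v hv
    obtain ⟨⟨⟨j, a⟩, x⟩, rfl⟩ := C.e.surjective v
    rw [C.block] at hv
    obtain rfl : j = i := hv
    have := C.exists_lift_eq ![(j, 0), (j, 1)] ![s, -t] 0
      (by simpa [← sub_eq_add_neg, sub_eq_zero] using hst) a x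
    fin_cases a <;> exact this
  -- Automorphisms carry this cycle to every block and any starting vertex.
  have hpath : ∀ v, ∃ f : ℕ → V, f 0 = v ∧ (∀ n, X.Adj (f n) (f (n + 1))) ∧
      (∀ n, b (f n) = b v) ∧ ∀ u, b u = b v → ∃ n < 2 * p, f n = u := by
    intro v
    obtain ⟨g, hg, hgb⟩ := hG (h 0) v
    refine ⟨fun n => g (h n), hg, fun n => g.map_adj_iff.2 (hadj n), fun n => ?_, fun u hu => ?_⟩
    · rw [← hg, hgb, hb, hb]
    · obtain ⟨w, rfl⟩ := g.surjective u
      rw [← hg, hgb, hb] at hu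
      obtain ⟨n, hn, hnw⟩ := hsurj w hu
      exact ⟨n, hn, congrArg g hnw⟩
  have hnext : ∀ v j, b v ≠ j → ∃ w, X.Adj v w ∧ b w = j := by
    intro v j hv
    obtain ⟨⟨u, x⟩, rfl⟩ := C.e.surjective v
    rw [C.block] at hv
    obtain ⟨a, t, ht⟩ := hcross u j hv
    exact ⟨C.e ((j, a), x + t), ht.adj rfl, C.block _ _⟩
  obtain ⟨f, hf0, hf, hfb, hfs⟩ := hpath (C.e (0, 0))
  have hb0 : b (C.e (0, 0)) = 0 := C.block _ _
  obtain ⟨w, hw, hw1⟩ := hnext (f (2 * p - 1)) 1 (by rw [hfb, hb0]; decide)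
  obtain ⟨f', hf0', hf', hfb', hfs'⟩ := hpath w
  obtain ⟨z, hz, hz2⟩ := hnext (f' (2 * p - 1)) 2 (by rw [hfb', hw1]; decide)
  obtain ⟨f'', hf0'', hf'', hfb'', hfs''⟩ := hpath z
  have hpos : 0 < 2 * p := by have := hp.pos; omega
  refine hasHamiltonPath_of_segments X (fun k => if k = 0 then f else if k = 1 then f' else f'')
    3 (2 * p) hpos (by norm_num) (by rw [C.card_eq]; ring) (fun k _ n _ => ?_) (fun k hk => ?_)
    (fun v => ?_)
  · split_ifs
    · exact hf n
    · exact hf' n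
    · exact hf'' n
  · obtain rfl | rfl : k = 0 ∨ k = 1 := by omega
    · simpa [hf0'] using hw
    · simpa [hf0''] using hz
  · have : b v = 0 ∨ b v = 1 ∨ b v = 2 := by generalize b v = k; revert k; decide
    rcases this with h | h | h
    · exact ⟨0, by norm_num, hfs v (h.trans hb0.symm)⟩
    · exact ⟨1, by norm_num, hfs' v (h.trans hw1.symm)⟩
    · exact ⟨2, by norm_num, hfs'' v (h.trans hz2.symm)⟩

/-- Two triangles in the quotient, the steps of each of which do not add up to `0`, give two cycles,
and hence a Hamilton path if they are joined by an edge. -/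
theorem hasHamiltonPath_of_triangles (c d : Fin 3 → ZMod p) (r : ZMod p)
    (hc : ∀ i, C.Step (i, 0) (i + 1, 0) (c i)) (hd : ∀ i, C.Step (i, 1) (i + 1, 1) (d i))
    (hr : C.Step (2, 0) (2, 1) r) (hcs : ∑ i, c i ≠ 0) (hds : ∑ i, d i ≠ 0) :
    HasHamiltonPath X := by
  have hp : p.Prime := Fact.out
  let f := C.lift (fun i : Fin 3 => (i, 0)) c 0
  have hlast : Fin.ofNat 3 (3 * p - 1) = 2 := by
    apply Fin.ext
    have := hp.pos
    simp only [Fin.ofNat, Fin.isValue]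
    change (3 * p - 1) % 3 = 2
    omega
  let y : ZMod p := 0 + ∑ j ∈ Finset.range (3 * p - 1), c (Fin.ofNat 3 j)
  have hfl : f (3 * p - 1) = C.e ((2, 0), y) := by
    change C.e ((Fin.ofNat 3 (3 * p - 1), 0), y) = _
    rw [hlast]
  -- The first cycle stops over block 2, as `3 * p - 1` is 2 modulo 3, so the second triangle is
  -- rotated to start there.
  let f' := C.lift (fun i : Fin 3 => (i + 2, 1)) (fun i => d (i + 2)) (y + r)
  have hf0' : f' 0 = C.e ((2, 1), y + r) := by
    change C.e ((Fin.ofNat 3 0 + 2, 1), y + r + ∑ j ∈ Finset.range 0, _) = _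
    rw [Finset.sum_range_zero, add_zero]
    rfl
  refine hasHamiltonPath_of_segments X (fun k => if k = 0 then f else f')
    2 (3 * p) (by have := hp.pos; omega) (by norm_num) (by rw [C.card_eq]; ring)
    (fun k _ n _ => ?_) (fun k hk => ?_) (fun v => ?_)
  · split_ifs
    · exact C.adj_lift_succ _ _ _ hc n
    · refine C.adj_lift_succ _ _ _ (fun i => ?_) n
      have := hd (i + 2)
      rwa [add_right_comm] at this
  · obtain rfl : k = 0 := by omega
    simp only [if_true, zero_add, one_ne_zero, if_false]
    rw [hfl, hf0']
    exact hr.adj rfl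
  · obtain ⟨⟨⟨i, a⟩, x⟩, rfl⟩ := C.e.surjective v
    fin_cases a
    · exact ⟨0, by norm_num, C.exists_lift_eq (fun i : Fin 3 => (i, 0)) c 0 hcs i x⟩
    · have h2 : ∑ i, d (i + 2) ≠ 0 := by
        exact fun h => hds ((Equiv.sum_comp (Equiv.addRight (2 : Fin 3)) d).symm.trans h)
      have := C.exists_lift_eq (fun i : Fin 3 => (i + 2, 1)) (fun i => d (i + 2)) (y + r) h2
        (i - 2) x
      simp only [sub_add_cancel] at this
      exact ⟨1, by norm_num, this⟩

end CyclicCoordinates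

/-! ### Quotients whose Hamilton cycles all have voltage sum zero -/

namespace CyclicCoordinates

variable {X : SimpleGraph V} {b : V → Fin 3} {p : ℕ} [Fact p.Prime]
  (C : CyclicCoordinates X b p) [Fintype V] [DecidableEq V]

theorem sum_eq_zero_of_cycle (hX : ¬ HasHamiltonPath X) (u : Fin 6 → Fin 3 × Fin 2)
    (hu : Function.Surjective u) {s₀ s₁ s₂ s₃ s₄ s₅ : ZMod p} (h₀ : C.Step (u 0) (u 1) s₀)
    (h₁ : C.Step (u 1) (u 2) s₁) (h₂ : C.Step (u 2) (u 3) s₂) (h₃ : C.Step (u 3) (u 4) s₃)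
    (h₄ : C.Step (u 4) (u 5) s₄) (h₅ : C.Step (u 5) (u 0) s₅) :
    s₀ + s₁ + s₂ + s₃ + s₄ + s₅ = 0 := by
  by_contra h
  refine hX (C.hasHamiltonPath_of_cycle u ![s₀, s₁, s₂, s₃, s₄, s₅] hu (fun i => ?_) ?_)
  · fin_cases i
    exacts [h₀, h₁, h₂, h₃, h₄, h₅]
  · simpa [Fin.sum_univ_succ, add_assoc] using h

/-- Replacing one of two parallel edges by the other changes the sum along the cycle, so the two
sums cannot both vanish. -/
theorem mult_le_one_of_cycle (hX : ¬ HasHamiltonPath X) (u : Fin 6 → Fin 3 × Fin 2)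
    (hu : Function.Surjective u) (hpos : ∀ k, 0 < C.mult (u k) (u (k + 1))) (k : Fin 6) :
    C.mult (u k) (u (k + 1)) ≤ 1 := by
  by_contra! h
  obtain ⟨s, t, hs, ht, hst⟩ := C.one_lt_mult_iff.1 h
  choose c hc using fun k => C.mult_pos_iff.1 (hpos k)
  have key : ∀ s, C.Step (u k) (u (k + 1)) s → ∑ i, Function.update c k s i = 0 := by
    intro s hs
    by_contra hne
    refine hX (C.hasHamiltonPath_of_cycle u (Function.update c k s) hu (fun i => ?_) hne)
    by_cases hi : i = k
    · subst hi
      rwa [Function.update_self]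
    · rw [Function.update_of_ne hi]
      exact hc i
  have h1 := key s hs
  have h2 := key t ht
  rw [Finset.sum_update_of_mem (Finset.mem_univ _)] at h1 h2
  exact hst (by linear_combination h1 - h2)

theorem hexagon_edge (hX : ¬ HasHamiltonPath X) {q : Fin 6 → Fin 3 × Fin 2}
    (hq : Function.Surjective q) {c : Fin 6 → ZMod p} (hc : ∀ k, C.Step (q k) (q (k + 1)) (c k))
    {t : ZMod p} (ht : C.Step (q 0) (q 1) t) : t = c 0 := by
  have h1 := C.sum_eq_zero_of_cycle hX q hq ht (hc 1) (hc 2) (hc 3) (hc 4) (hc 5)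
  have h2 := C.sum_eq_zero_of_cycle hX q hq (hc 0) (hc 1) (hc 2) (hc 3) (hc 4) (hc 5)
  linear_combination h1 - h2

/-- Let `δ k` be the voltage of the chord from `q k` minus that of the arc it spans. Three Hamilton
cycles, each with two crossing chords, give `δ 0 + δ 1 = δ 1 + δ 2 = δ 5 + δ 0 = 0`; a fourth gives
`δ 0 + δ 2 = δ 1 + δ 5`. Hence `4 * δ 0 = 0`. -/
theorem hexagon_short_chord (hX : ¬ HasHamiltonPath X) {q : Fin 6 → Fin 3 × Fin 2}
    (hq : Function.Surjective q) {c : Fin 6 → ZMod p} (hc : ∀ k, C.Step (q k) (q (k + 1)) (c k))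
    (hp : 2 < p) {t₀ t₁ t₂ t₅ : ZMod p} (h₀ : C.Step (q 0) (q 2) t₀)
    (h₁ : C.Step (q 1) (q 3) t₁) (h₂ : C.Step (q 2) (q 4) t₂) (h₅ : C.Step (q 5) (q 1) t₅) :
    t₀ = c 0 + c 1 := by
  have e := C.sum_eq_zero_of_cycle hX q hq (hc 0) (hc 1) (hc 2) (hc 3) (hc 4) (hc 5)
  have e0 := C.sum_eq_zero_of_cycle hX (q ∘ ![0, 2, 1, 3, 4, 5]) (hq.comp (by decide))
    h₀ (hc 1).symm h₁ (hc 3) (hc 4) (hc 5)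
  have e1 := C.sum_eq_zero_of_cycle hX (q ∘ ![1, 3, 2, 4, 5, 0]) (hq.comp (by decide))
    h₁ (hc 2).symm h₂ (hc 4) (hc 5) (hc 0)
  have e5 := C.sum_eq_zero_of_cycle hX (q ∘ ![5, 1, 0, 2, 3, 4]) (hq.comp (by decide))
    h₅ (hc 0).symm h₀ (hc 2) (hc 3) (hc 4)
  have e' := C.sum_eq_zero_of_cycle hX (q ∘ ![0, 2, 4, 3, 1, 5]) (hq.comp (by decide))
    h₀ h₂ (hc 3).symm h₁.symm h₅.symm (hc 5)
  have h2 : (2 : ZMod p) ≠ 0 := by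
    have : Fact (2 < p) := ⟨hp⟩
    exact Ring.two_ne_zero (by rw [ZMod.ringChar_zmod_n]; omega)
  have h4 : (2 * 2 : ZMod p) * (t₀ - c 0 - c 1) = 0 := by
    linear_combination e' + 2 * e0 - e1 + e5 - 2 * e
  have := (mul_eq_zero.1 h4).resolve_left (mul_ne_zero h2 h2)
  linear_combination this

theorem hexagon_long_chord_of_short (hX : ¬ HasHamiltonPath X) {q : Fin 6 → Fin 3 × Fin 2}
    (hq : Function.Surjective q) {c : Fin 6 → ZMod p} (hc : ∀ k, C.Step (q k) (q (k + 1)) (c k))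
    {t t₁ t₂ : ZMod p} (h : C.Step (q 0) (q 3) t)
    (h₁ : C.Step (q 1) (q 3) t₁) (h₂ : C.Step (q 2) (q 4) t₂) (ht₁ : t₁ = c 1 + c 2)
    (ht₂ : t₂ = c 2 + c 3) : t = c 0 + c 1 + c 2 := by
  have e := C.sum_eq_zero_of_cycle hX q hq (hc 0) (hc 1) (hc 2) (hc 3) (hc 4) (hc 5)
  have e0 := C.sum_eq_zero_of_cycle hX (q ∘ ![0, 3, 1, 2, 4, 5]) (hq.comp (by decide))
    h h₁.symm (hc 1) h₂ (hc 4) (hc 5)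
  linear_combination e0 - e + ht₁ - ht₂

/-- With `δ k` the deviation of a chord from its arc, the three cycles give `δ 0 + δ 1 = 0`, `δ 1 +
δ 2 = 0` and `δ 0 - δ 1 + δ 2 = 0`, so `3 * δ 0 = 0`. -/
theorem hexagon_long_chord (hX : ¬ HasHamiltonPath X) {q : Fin 6 → Fin 3 × Fin 2}
    (hq : Function.Surjective q) {c : Fin 6 → ZMod p} (hc : ∀ k, C.Step (q k) (q (k + 1)) (c k))
    (hp : 3 < p) {t₀ t₁ t₂ : ZMod p} (h₀ : C.Step (q 0) (q 3) t₀)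
    (h₁ : C.Step (q 1) (q 4) t₁) (h₂ : C.Step (q 2) (q 5) t₂) : t₀ = c 0 + c 1 + c 2 := by
  have e := C.sum_eq_zero_of_cycle hX q hq (hc 0) (hc 1) (hc 2) (hc 3) (hc 4) (hc 5)
  have e0 := C.sum_eq_zero_of_cycle hX (q ∘ ![0, 3, 2, 1, 4, 5]) (hq.comp (by decide))
    h₀ (hc 2).symm (hc 1).symm h₁ (hc 4) (hc 5)
  have e1 := C.sum_eq_zero_of_cycle hX (q ∘ ![1, 4, 3, 2, 5, 0]) (hq.comp (by decide))
    h₁ (hc 3).symm (hc 2).symm h₂ (hc 5) (hc 0)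
  have e2 := C.sum_eq_zero_of_cycle hX (q ∘ ![0, 3, 4, 1, 2, 5]) (hq.comp (by decide))
    h₀ (hc 3) h₁.symm (hc 1) h₂ (hc 5)
  have h3 : (3 : ZMod p) ≠ 0 := fun h => by
    have := (ZMod.natCast_eq_zero_iff 3 p).1 (by exact_mod_cast h)
    exact absurd (Nat.le_of_dvd (by norm_num) this) (by omega)
  have h4 : (3 : ZMod p) * (t₀ - c 0 - c 1 - c 2) = 0 := by
    linear_combination e2 + 2 * e0 - e1 - 2 * e
  have := (mul_eq_zero.1 h4).resolve_left h3
  linear_combination this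

/-- A quotient that is a hexagon, with all or none of the short chords and all or none of the long
ones, has a Hamilton cycle that lifts to a Hamilton path. -/
theorem false_of_hexagon (hX : ¬ HasHamiltonPath X) {q : Fin 6 → Fin 3 × Fin 2}
    (hq : Function.Surjective q) (hp : 3 < p) (hconn : X.Connected)
    (hedge : ∀ k, ∃ t, C.Step (q k) (q (k + 1)) t) (hself : ∀ k t, ¬ C.Step (q k) (q k) t)
    (hshort : (∀ k, ∃ t, C.Step (q k) (q (k + 2)) t) ∨ ∀ k t, ¬ C.Step (q k) (q (k + 2)) t)
    (hlong : (∀ k, ∃ t, C.Step (q k) (q (k + 3)) t) ∨ ∀ k t, ¬ C.Step (q k) (q (k + 3)) t) :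
    False := by
  choose c hc using hedge
  have hrot : ∀ k, Function.Surjective fun l => q (k + l) := fun k =>
    hq.comp (Equiv.addLeft k).surjective
  have hcrot : ∀ k l, C.Step (q (k + l)) (q (k + (l + 1))) (c (k + l)) := fun k l => by
    rw [← add_assoc]; exact hc _
  have h1 : ∀ k t, C.Step (q k) (q (k + 1)) t → t = c k := by
    intro k t ht
    have := C.hexagon_edge hX (hrot k) (hcrot k) (t := t) (by simpa using ht)
    simpa using this
  have h2 : ∀ k t, C.Step (q k) (q (k + 2)) t → t = c k + c (k + 1) := by
    intro k t ht
    rcases hshort with hs | hs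
    · choose d hd using hs
      have hdrot : ∀ l, C.Step (q (k + l)) (q (k + (l + 2))) (d (k + l)) := fun l => by
        rw [← add_assoc]; exact hd _
      have := C.hexagon_short_chord hX (hrot k) (hcrot k) (by omega) (t₀ := t)
        (by simpa using ht) (hdrot 1) (hdrot 2) (hdrot 5)
      simpa using this
    · exact absurd ht (hs k t)
  have h3 : ∀ k t, C.Step (q k) (q (k + 3)) t → t = c k + c (k + 1) + c (k + 2) := by
    intro k t ht
    rcases hlong with hl | hl
    · rcases hshort with hs | hs
      · choose d hd using hs
        have hdrot : ∀ l, C.Step (q (k + l)) (q (k + (l + 2))) (d (k + l)) := fun l => by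
          rw [← add_assoc]; exact hd _
        have hd' : ∀ l, d (k + l) = c (k + l) + c (k + (l + 1)) := fun l => by
          rw [← add_assoc]; exact h2 _ _ (hd _)
        have := C.hexagon_long_chord_of_short hX (hrot k) (hcrot k) (t := t)
          (by simpa using ht) (hdrot 1) (hdrot 2) (hd' 1) (hd' 2)
        simpa using this
      · choose d hd using hl
        have hdrot : ∀ l, C.Step (q (k + l)) (q (k + (l + 3))) (d (k + l)) := fun l => by
          rw [← add_assoc]; exact hd _
        have := C.hexagon_long_chord hX (hrot k) (hcrot k) hp (t₀ := t)
          (by simpa using ht) (hdrot 1) (hdrot 2)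
        simpa using this
    · exact absurd ht (hl k t)
  have hsum := C.sum_eq_zero_of_cycle hX q hq (hc 0) (hc 1) (hc 2) (hc 3) (hc 4) (hc 5)
  -- The potential adds up voltages around the hexagon; `hsum` makes it close up.
  let ψ : Fin 6 → ZMod p :=
    ![0, c 0, c 0 + c 1, c 0 + c 1 + c 2, c 0 + c 1 + c 2 + c 3, c 0 + c 1 + c 2 + c 3 + c 4]
  have hψ : ∀ k, ψ (k + 1) = ψ k + c k := by
    intro k
    fin_cases k
    · exact (zero_add _).symm
    · rfl
    · rfl
    · rfl
    · rfl
    · exact hsum.symm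
  have hψ2 : ∀ k, ψ (k + 2) = ψ k + c k + c (k + 1) := fun k => by
    rw [← hψ, ← hψ, add_assoc]; rfl
  have hψ3 : ∀ k, ψ (k + 3) = ψ k + c k + c (k + 1) + c (k + 2) := fun k => by
    rw [← hψ2, ← hψ, add_assoc]; rfl
  have hbij : Function.Bijective q := by
    rw [Fintype.bijective_iff_surjective_and_card]
    exact ⟨hq, rfl⟩
  let ε := Equiv.ofBijective q hbij
  have hε : ∀ k, ε.symm (q k) = k := fun k => ε.symm_apply_apply k
  refine C.false_of_potential hconn (fun v => ψ (ε.symm v)) fun v w t ht => ?_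
  obtain ⟨k, rfl⟩ := hq v
  obtain ⟨l, rfl⟩ := hq w
  simp only [hε]
  obtain ⟨j, rfl⟩ : ∃ j, l = k + j := ⟨l - k, by abel⟩
  -- Differences 4 and 5 are the short chords and edges read backwards.
  have hback : ∀ m n : Fin 6, m + n = 0 → k = k + m + n := fun m n h => by
    rw [add_assoc, h, add_zero]
  fin_cases j
  · exact absurd (by simpa using ht) (hself k t)
  · have := h1 k t ht
    have e := hψ k
    simp only [Fin.mk_one]
    linear_combination this - e
  · have := h2 k t ht
    have e := hψ2 k
    simp only [Fin.reduceFinMk]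
    linear_combination this - e
  · have := h3 k t ht
    have e := hψ3 k
    simp only [Fin.reduceFinMk]
    linear_combination this - e
  · simp only [Fin.reduceFinMk] at ht ⊢
    have hk := hback 4 2 rfl
    have hs := ht.symm
    have := h2 (k + 4) (-t) (by rwa [← hk])
    have e := hψ2 (k + 4)
    rw [← hk] at e
    linear_combination -this + e
  · simp only [Fin.reduceFinMk] at ht ⊢
    have hk := hback 5 1 rfl
    have hs := ht.symm
    have := h1 (k + 5) (-t) (by rwa [← hk])
    have e := hψ (k + 5)
    rw [← hk] at e
    linear_combination -this + e

/-- A prism as the quotient. -/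
theorem false_of_prism (hX : ¬ HasHamiltonPath X) (hp : 3 < p) (hconn : X.Connected)
    (hedge : ∀ i a, ∃ t, C.Step (i, a) (i + 1, a) t) (hrung : ∀ i, ∃ t, C.Step (i, 0) (i, 1) t)
    (hself : ∀ u t, ¬ C.Step u u t)
    (hcross : ∀ i j t, i ≠ j → ¬ C.Step (i, 0) (j, 1) t) : False := by
  have key : ∀ i {t₁ t₂ s₁ s₂ r r'}, C.Step (i, 0) (i + 1, 0) t₁ →
      C.Step (i + 1, 0) (i + 2, 0) t₂ → C.Step (i, 1) (i + 1, 1) s₁ →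
      C.Step (i + 1, 1) (i + 2, 1) s₂ → C.Step (i, 0) (i, 1) r →
      C.Step (i + 2, 0) (i + 2, 1) r' → t₁ + t₂ + r' = r + s₁ + s₂ := by
    intro i t₁ t₂ s₁ s₂ r r' ht₁ ht₂ hs₁ hs₂ hr hr'
    have := C.sum_eq_zero_of_cycle hX
      ![(i, 0), (i + 1, 0), (i + 2, 0), (i + 2, 1), (i + 1, 1), (i, 1)] (by clear * -; decide +revert)
      ht₁ ht₂ hr' hs₂.symm hs₁.symm hr.symm
    linear_combination this
  choose e he using hedge
  choose r hr using hrung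
  have he' : ∀ i a, C.Step (i + 1, a) (i + 2, a) (e (i + 1) a) := fun i a => by
    have := he (i + 1) a
    rwa [add_assoc] at this
  have hkey := fun i => key i (he i 0) (he' i 0) (he i 1) (he' i 1) (hr i) (hr (i + 2))
  have h0 : ∀ i t, C.Step (i, 0) (i + 1, 0) t → t = e i 0 := fun i t ht => by
    linear_combination key i ht (he' i 0) (he i 1) (he' i 1) (hr i) (hr (i + 2)) - hkey i
  have h1 : ∀ i t, C.Step (i, 1) (i + 1, 1) t → t = e i 1 := fun i t ht => by
    linear_combination -key i (he i 0) (he' i 0) ht (he' i 1) (hr i) (hr (i + 2)) + hkey i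
  have hrr : ∀ i t, C.Step (i, 0) (i, 1) t → t = r i := fun i t ht => by
    linear_combination -key i (he i 0) (he' i 0) (he i 1) (he' i 1) ht (hr (i + 2)) + hkey i
  have k0 : e 0 0 + e 1 0 + r 2 = r 0 + e 0 1 + e 1 1 := hkey 0
  have k1 : e 1 0 + e 2 0 + r 0 = r 1 + e 1 1 + e 2 1 := hkey 1
  have k2 : e 2 0 + e 0 0 + r 1 = r 2 + e 2 1 + e 0 1 := hkey 2
  have h2 : (2 : ZMod p) ≠ 0 := Ring.two_ne_zero (by rw [ZMod.ringChar_zmod_n]; omega)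
  -- In the sum of the three equations the rungs cancel and each triangle edge counts twice.
  have heq : e 0 0 + e 1 0 + e 2 0 = e 0 1 + e 1 1 + e 2 1 := by
    refine mul_left_cancel₀ h2 ?_
    linear_combination k0 + k1 + k2
  have hz : e 0 0 + e 1 0 + e 2 0 = 0 := by
    by_contra hne
    exact hX (C.hasHamiltonPath_of_triangles (fun i => e i 0) (fun i => e i 1) (r 2)
      (fun i => he i 0) (fun i => he i 1) (hr 2) (by simpa [Fin.sum_univ_three] using hne)
      (by simpa [Fin.sum_univ_three, ← heq] using hne))
  let ψ : Fin 3 → ZMod p := ![0, e 0 0, e 0 0 + e 1 0]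
  have hψ : ∀ i, ψ (i + 1) = ψ i + e i 0 := by
    intro i
    fin_cases i
    · exact (zero_add _).symm
    · rfl
    · exact hz.symm
  have hδ : ∀ i, e i 1 = e i 0 + r (i + 1) - r i := by
    intro i
    fin_cases i
    · change e 0 1 = e 0 0 + r 1 - r 0
      linear_combination k1 - heq
    · change e 1 1 = e 1 0 + r 2 - r 1
      linear_combination k2 - heq
    · change e 2 1 = e 2 0 + r 0 - r 2
      linear_combination k0 - heq
  have hfwd : ∀ i t a, C.Step (i, a) (i + 1, a) t →
      t = (ψ (i + 1) + ![0, r (i + 1)] a) - (ψ i + ![0, r i] a) := by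
    intro i t a ht
    rw [hψ]
    fin_cases a
    · change t = (ψ i + e i 0 + 0) - (ψ i + 0)
      linear_combination h0 i t ht
    · change t = (ψ i + e i 0 + r (i + 1)) - (ψ i + r i)
      linear_combination h1 i t ht + hδ i
  refine C.false_of_potential hconn (fun v => ψ v.1 + ![0, r v.1] v.2) ?_
  rintro ⟨i, a⟩ ⟨j, a'⟩ t ht
  by_cases haa : a = a'
  · subst haa
    obtain rfl | rfl | rfl : j = i ∨ j = i + 1 ∨ i = j + 1 := by clear * -; decide +revert
    · exact absurd ht (hself _ _)
    · exact hfwd i t a ht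
    · linear_combination -hfwd j (-t) a ht.symm
  · by_cases hij : i = j
    · subst hij
      fin_cases a <;> fin_cases a'
      · exact absurd rfl haa
      · change t = (ψ i + r i) - (ψ i + 0)
        linear_combination hrr i t ht
      · change t = (ψ i + 0) - (ψ i + r i)
        linear_combination -hrr i (-t) ht.symm
      · exact absurd rfl haa
    · fin_cases a <;> fin_cases a'
      · exact absurd rfl haa
      · exact absurd ht (hcross i j t hij)
      · exact absurd ht.symm (hcross j i (-t) (Ne.symm hij))
      · exact absurd rfl haa

/-! ### The cases of the valency inside the blocks -/

/-- If all blocks induce graphs of valency at least two, then orbits joined by matchings only are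
not empty. -/
theorem hasHamiltonPath_of_two_le (hconn : X.Connected) {d r : ℕ}
    (hd : ∀ i j a, i ≠ j → C.mult (i, a) (j, 0) + C.mult (i, a) (j, 1) = d)
    (hr : ∀ i a, C.mult (i, a) (i, 0) + C.mult (i, a) (i, 1) = r) (hr2 : 2 ≤ r)
    (hle : ∀ i, C.mult (i, 0) (i, 1) ≤ 1) (h01 : 0 < C.mult (0, 0) (1, 0))
    (h12 : 0 < C.mult (1, 0) (2, 0)) : HasHamiltonPath X := by
  have hd0 := C.valency_pos hconn hd
  have hself : ∀ u, ∃ s, C.Step u u s := by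
    rintro ⟨i, a⟩
    refine C.mult_pos_iff.1 ?_
    have h1 := hr i 0
    have h2 := hr i 1
    have h3 := C.mult_comm (i, 1) (i, 0)
    have h4 := hle i
    fin_cases a
    · change 0 < C.mult (i, 0) (i, 0)
      omega
    · change 0 < C.mult (i, 1) (i, 1)
      omega
  have h01' := C.mult_one_eq hd (show (0 : Fin 3) ≠ 1 by decide)
  have h12' := C.mult_one_eq hd (show (1 : Fin 3) ≠ 2 by decide)
  have h20' := C.mult_one_eq hd (show (2 : Fin 3) ≠ 0 by decide)
  have hwalk : ∀ u : Fin 6 → Fin 3 × Fin 2, Function.Surjective u →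
      (∀ k : Fin 5, 0 < C.mult (u k.castSucc) (u k.succ)) → HasHamiltonPath X := by
    intro u hu hpos
    refine C.hasHamiltonPath_of_path (fun k => u (Fin.ofNat 6 k)) (fun v => ?_) (fun k hk => ?_)
      hself
    · obtain ⟨k, rfl⟩ := hu v
      exact ⟨k, k.2, by congr 1; apply Fin.ext; simp⟩
    · refine C.mult_pos_iff.1 ?_
      interval_cases k
      exacts [hpos 0, hpos 1, hpos 2, hpos 3, hpos 4]
  rcases Nat.eq_zero_or_pos (C.mult (2, 0) (0, 1)) with h20 | h20
  · have hsucc : ∀ i a, 0 < C.mult (i, a) (i + 1, a) := by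
      have hs := hd 2 0 0 (by decide)
      intro i a
      fin_cases i <;> fin_cases a
      · exact h01
      · exact h01'.2 ▸ h01
      · exact h12
      · exact h12'.2 ▸ h12
      · change 0 < C.mult (2, 0) (0, 0)
        omega
      · change 0 < C.mult (2, 1) (0, 1)
        omega
    -- The quotient contains two triangles; by connectedness some edge joins them, and a Hamilton
    -- path runs around one, across, and around the other.
    obtain ⟨i, j, hij⟩ : ∃ i j, 0 < C.mult (i, 0) (j, 1) := by
      by_contra! hno
      have := C.invariant_const hconn Prod.snd (fun q q' t ht => by
        obtain ⟨i, a⟩ := q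
        obtain ⟨j, a'⟩ := q'
        have hno' : ∀ i j, C.mult (i, 0) (j, 1) = 0 := fun i j => by have := hno i j; omega
        fin_cases a <;> fin_cases a'
        · rfl
        · exact absurd ht (C.not_step_of_mult_eq_zero (hno' i j) t)
        · exact absurd ht.symm (C.not_step_of_mult_eq_zero (hno' j i) (-t))
        · rfl) (0, 0) (0, 1)
      exact absurd this (by decide)
    refine hwalk ![(i + 1, 0), (i + 2, 0), (i, 0), (j, 1), (j + 1, 1), (j + 2, 1)]
      (by clear * -; decide +revert) (fun k => ?_)
    have e : ∀ i : Fin 3, i + 1 + 1 = i + 2 ∧ i + 2 + 1 = i := by decide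
    fin_cases k
    · have := hsucc (i + 1) 0
      rwa [(e i).1] at this
    · have := hsucc (i + 2) 0
      rwa [(e i).2] at this
    · exact hij
    · exact hsucc j 1
    · have := hsucc (j + 1) 1
      rwa [(e j).1] at this
  · refine hwalk ![(0, 0), (1, 0), (2, 0), (0, 1), (1, 1), (2, 1)] (by decide) (fun k => ?_)
    fin_cases k
    exacts [h01, h12, h20, h01'.2 ▸ h01, h12'.2 ▸ h12]

/-- The case of blocks that induce graphs of valency at most one. -/
theorem hasHamiltonPath_of_le_one (hp : 3 < p) (hconn : X.Connected) {d r : ℕ}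
    (hd : ∀ i j a, i ≠ j → C.mult (i, a) (j, 0) + C.mult (i, a) (j, 1) = d)
    (hr : ∀ i a, C.mult (i, a) (i, 0) + C.mult (i, a) (i, 1) = r) (hr1 : r ≤ 1)
    (h01 : C.mult (0, 0) (1, 1) ≤ C.mult (0, 0) (1, 0))
    (h12 : C.mult (1, 0) (2, 1) ≤ C.mult (1, 0) (2, 0)) : HasHamiltonPath X := by
  by_contra hX
  have hd0 := C.valency_pos hconn hd
  have hself : ∀ u, C.mult u u = 0 := by
    rintro ⟨i, a⟩
    have h1 := hr i a
    have h2 := C.mult_self_eq_zero_or (by omega) (i, a)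
    fin_cases a
    · change C.mult (i, 0) (i, 0) = 0
      change _ ∨ 1 < C.mult (i, 0) (i, 0) at h2
      simp only [Fin.zero_eta] at h1 h2
      omega
    · change C.mult (i, 1) (i, 1) = 0
      simp only [Fin.mk_one] at h1 h2
      omega
  have hrung : ∀ i, C.mult (i, 0) (i, 1) = r := fun i => by
    have := hr i 0
    rwa [hself, zero_add] at this
  have hrung' : ∀ i, C.mult (i, 1) (i, 0) = r := fun i => by rw [C.mult_comm, hrung]
  have e01 := C.mult_one_eq hd (show (0 : Fin 3) ≠ 1 by decide)
  have e12 := C.mult_one_eq hd (show (1 : Fin 3) ≠ 2 by decide)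
  have e20 := C.mult_one_eq hd (show (2 : Fin 3) ≠ 0 by decide)
  have s01 := hd 0 1 0 (by decide)
  have s12 := hd 1 2 0 (by decide)
  have s20 := hd 2 0 0 (by decide)
  rcases Nat.eq_zero_or_pos (C.mult (2, 0) (0, 1)) with h20 | h20
  -- Otherwise `d ≥ 2`, as the multiplicity in `h01` is also positive; but the hexagon below uses
  -- the edge from `(2, 0)` to `(0, 0)`, of multiplicity `d`.
  · have z01 : C.mult (0, 0) (1, 1) = 0 := by
      by_contra hne
      have := C.mult_le_one_of_cycle hX ![(0, 0), (1, 1), (2, 1), (0, 1), (1, 0), (2, 0)]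
        (by decide) (fun k => by
          fin_cases k
          · change 0 < C.mult (0, 0) (1, 1)
            omega
          · change 0 < C.mult (1, 1) (2, 1)
            omega
          · change 0 < C.mult (2, 1) (0, 1)
            omega
          · change 0 < C.mult (0, 1) (1, 0)
            omega
          · change 0 < C.mult (1, 0) (2, 0)
            omega
          · change 0 < C.mult (2, 0) (0, 0)
            omega) 5
      change C.mult (2, 0) (0, 0) ≤ 1 at this
      omega
    have z12 : C.mult (1, 0) (2, 1) = 0 := by
      by_contra hne
      have := C.mult_le_one_of_cycle hX ![(1, 0), (2, 1), (0, 1), (1, 1), (2, 0), (0, 0)]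
        (by decide) (fun k => by
          fin_cases k
          · change 0 < C.mult (1, 0) (2, 1)
            omega
          · change 0 < C.mult (2, 1) (0, 1)
            omega
          · change 0 < C.mult (0, 1) (1, 1)
            omega
          · change 0 < C.mult (1, 1) (2, 0)
            omega
          · change 0 < C.mult (2, 0) (0, 0)
            omega
          · change 0 < C.mult (0, 0) (1, 0)
            omega) 4
      change C.mult (2, 0) (0, 0) ≤ 1 at this
      omega
    have hcross : ∀ i j, i ≠ j → C.mult (i, 0) (j, 1) = 0 := by
      intro i j hij
      have c01 := C.mult_comm (1, 0) (0, 1)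
      have c12 := C.mult_comm (2, 0) (1, 1)
      have c20 := C.mult_comm (0, 0) (2, 1)
      fin_cases i <;> fin_cases j <;>
        first
        | exact absurd rfl hij
        | exact z01
        | exact z12
        | exact h20
        | exact c01.trans (e01.1.trans z01)
        | exact c12.trans (e12.1.trans z12)
        | exact c20.trans (e20.1.trans h20)
    rcases Nat.eq_zero_or_pos r with hr0 | hr0
    · have hno : ∀ i j, C.mult (i, 0) (j, 1) = 0 := fun i j => by
        by_cases hij : i = j
        · rw [hij, hrung, hr0]
        · exact hcross i j hij
      have := C.invariant_const hconn Prod.snd (fun q q' t ht => by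
        obtain ⟨i, a⟩ := q
        obtain ⟨j, a'⟩ := q'
        fin_cases a <;> fin_cases a'
        · rfl
        · exact absurd ht (C.not_step_of_mult_eq_zero (hno i j) t)
        · exact absurd ht.symm (C.not_step_of_mult_eq_zero (hno j i) (-t))
        · rfl) (0, 0) (0, 1)
      exact absurd this (by decide)
    · refine C.false_of_prism hX hp hconn (fun i a => C.mult_pos_iff.1 ?_)
        (fun i => C.mult_pos_iff.1 ((hrung i).symm ▸ hr0))
        (fun u => C.not_step_of_mult_eq_zero (hself u))
        (fun i j t hij => C.not_step_of_mult_eq_zero (hcross i j hij) t)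
      fin_cases i <;> fin_cases a
      · change 0 < C.mult (0, 0) (1, 0)
        omega
      · change 0 < C.mult (0, 1) (1, 1)
        omega
      · change 0 < C.mult (1, 0) (2, 0)
        omega
      · change 0 < C.mult (1, 1) (2, 1)
        omega
      · change 0 < C.mult (2, 0) (0, 0)
        omega
      · change 0 < C.mult (2, 1) (0, 1)
        omega
  · let q : Fin 6 → Fin 3 × Fin 2 := ![(0, 0), (1, 0), (2, 0), (0, 1), (1, 1), (2, 1)]
    have hq : Function.Surjective q := by decide
    have hpos : ∀ k, 0 < C.mult (q k) (q (k + 1)) := by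
      have c20 := C.mult_comm (2, 1) (0, 0)
      intro k
      fin_cases k
      · change 0 < C.mult (0, 0) (1, 0)
        omega
      · change 0 < C.mult (1, 0) (2, 0)
        omega
      · exact h20
      · change 0 < C.mult (0, 1) (1, 1)
        omega
      · change 0 < C.mult (1, 1) (2, 1)
        omega
      · change 0 < C.mult (2, 1) (0, 0)
        omega
    have m0 : C.mult (0, 0) (1, 0) ≤ 1 := C.mult_le_one_of_cycle hX q hq hpos 0
    have m1 : C.mult (1, 0) (2, 0) ≤ 1 := C.mult_le_one_of_cycle hX q hq hpos 1
    have m2 : C.mult (2, 0) (0, 1) ≤ 1 := C.mult_le_one_of_cycle hX q hq hpos 2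
    have p0 : 0 < C.mult (0, 0) (1, 0) := hpos 0
    have p1 : 0 < C.mult (1, 0) (2, 0) := hpos 1
    -- The short chords complement the hexagon edges, which are simple, to the valency `d`; the long
    -- chords join the two orbits of a block.
    have hshort : ∀ k, C.mult (q k) (q (k + 2)) = d - 1 := by
      intro k
      fin_cases k
      · change C.mult (0, 0) (2, 0) = d - 1
        rw [C.mult_comm]
        omega
      · change C.mult (1, 0) (0, 1) = d - 1
        rw [C.mult_comm]
        omega
      · change C.mult (2, 0) (1, 1) = d - 1
        rw [C.mult_comm]
        omega
      · change C.mult (0, 1) (2, 1) = d - 1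
        rw [C.mult_comm]
        omega
      · change C.mult (1, 1) (0, 0) = d - 1
        rw [C.mult_comm]
        omega
      · change C.mult (2, 1) (1, 0) = d - 1
        rw [C.mult_comm]
        omega
    have hlong : ∀ k, C.mult (q k) (q (k + 3)) = r := by
      intro k
      fin_cases k
      exacts [hrung 0, hrung 1, hrung 2, hrung' 0, hrung' 1, hrung' 2]
    have hor : ∀ (m : ℕ) (j : Fin 6), (∀ k, C.mult (q k) (q (k + j)) = m) →
        (∀ k, ∃ t, C.Step (q k) (q (k + j)) t) ∨ ∀ k t, ¬ C.Step (q k) (q (k + j)) t := by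
      intro m j hm
      rcases Nat.eq_zero_or_pos m with h | h
      · exact Or.inr fun k => C.not_step_of_mult_eq_zero ((hm k).trans h)
      · exact Or.inl fun k => C.mult_pos_iff.1 ((hm k).symm ▸ h)
    exact C.false_of_hexagon hX hq hp hconn (fun k => C.mult_pos_iff.1 (hpos k))
      (fun k => C.not_step_of_mult_eq_zero (hself _)) (hor _ 2 hshort) (hor _ 3 hlong)

end CyclicCoordinates

end VTGraph

theorem mainTheorem9 {V : Type*} [Fintype V] [DecidableEq V] (X : SimpleGraph V) (p : ℕ)
    (hp : p.Prime) (hp3 : 3 < p) (hcard : Fintype.card V = 6 * p) (hconn : X.Connected)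
    (ℬ : Set (Set V)) (hℬ : VTGraph.IsGenuinelyImprimitiveWith X ℬ)
    (hsize : ∀ B ∈ ℬ, B.ncard = 2 * p) :
    VTGraph.HasHamiltonPath X := by
  have : Fact p.Prime := ⟨hp⟩
  obtain ⟨b, hN, hG, ⟨C₀⟩⟩ := VTGraph.exists_blockMap_of_isGenuinelyImprimitiveWith X hp
    (by omega) hcard ℬ hℬ hsize
  obtain ⟨C, h01, h12⟩ := C₀.exists_mult_le
  obtain ⟨d, r, hd, hr⟩ := C.exists_valencies hN hG
  have hd0 := C.valency_pos hconn hd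
  by_cases hr1 : r ≤ 1
  · exact C.hasHamiltonPath_of_le_one hp3 hconn hd hr hr1 h01 h12
  by_cases hmult : ∃ i, 1 < C.mult (i, 0) (i, 1)
  · obtain ⟨i, hi⟩ := hmult
    refine C.hasHamiltonPath_of_one_lt_mult hi hG fun u j huj => ?_
    have : C.mult u (j, 0) + C.mult u (j, 1) = d := hd u.1 j u.2 huj
    rcases Nat.eq_zero_or_pos (C.mult u (j, 0)) with h | h
    · exact ⟨1, C.mult_pos_iff.1 (show 0 < C.mult u (j, 1) by omega)⟩
    · exact ⟨0, C.mult_pos_iff.1 h⟩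
  · have s01 := hd 0 1 0 (by decide)
    have s12 := hd 1 2 0 (by decide)
    exact C.hasHamiltonPath_of_two_le hconn hd hr (by omega) (fun i => by
      by_contra! h; exact hmult ⟨i, h⟩) (by omega) (by omega)
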